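/- Let $\Gamma$ be a compact connected metric graph, i.e. a finite connected graph (parallel edges and loops allowed) each of whose edges $e$ is identified with an interval $[0,L(e)]$, $0<L(e)<\infty$, with its path metric $\operatorname{dist}$. Let $-\Delta_\Gamma$ be the Laplacian in $L^2(\Gamma)$ with standard (continuity–Kirchhoff) vertex conditions: it acts as $f\mapsto -f''$ on each edge, on the functions $f$ that are continuous on $\Gamma$, are in $H^2$ on each edge, and for which at each vertex the derivatives of $f$ along the incident edges, taken in the direction towards the vertex, sum to $0$. Let $\mu_2(\Gamma)$ be its smallest positive eigenvalue. Consider real eigenfunctions only, and put $$M(\Gamma)=\Big\{x\in\Gamma:\ \psi(x)=\max_{y\in\Gamma}\psi(y)\ \text{for some eigenfunction }\psi\text{ corresponding to }\mu_2(\Gamma)\Big\},$$ $$M_{\mathrm{loc}}(\Gamma)=\Big\{x\in\Gamma:\ 0\neq\psi(x)=\max_{\operatorname{dist}(x,y)<\delta}\psi(y)\ \text{for some }\delta>0\text{ and some eigenfunction }\psi\text{ corresponding to }\mu_2(\Gamma)\Big\}.$$ **Proposition.** For every integer $n\ge 2$ there is a metric graph $\Gamma$ with $|M(\Gamma)|=|M_{\mathrm{loc}}(\Gamma)|=n$.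 Moreover, $\Gamma$ can be chosen to be a star with $n$ edges, of which one has length $1$ and the other $n-1$ have the same length $\varepsilon$, for some $\varepsilon\in(0,1)$. -/

import Mathlib

open Set MeasureTheory
open scoped ContDiff

noncomputable section

/-! ## Sobolev spaces on a bounded interval -/

/-- `g` is the weak derivative of `f` on the open interval `(0, ℓ)`. -/
def HasWeakDeriv (ℓ : ℝ) (f g : ℝ → ℝ) : Prop :=
  LocallyIntegrableOn f (Ioo 0 ℓ) volume ∧ LocallyIntegrableOn g (Ioo 0 ℓ) volume ∧
    ∀ φ : ℝ → ℝ, ContDiff ℝ ∞ φ → HasCompactSupport φ → tsupport φ ⊆ Ioo 0 ℓ →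
      ∫ x in Ioo 0 ℓ, f x * deriv φ x = -∫ x in Ioo 0 ℓ, g x * φ x

/-- `f` belongs to the Sobolev space `H^k(0, ℓ)`: it is in `L²(0, ℓ)`, with weak derivatives up to
order `k` in `L²(0, ℓ)`. -/
def MemSobolev (ℓ : ℝ) : ℕ → (ℝ → ℝ) → Prop
  | 0, f => MemLp f 2 (volume.restrict (Ioo 0 ℓ))
  | k + 1, f => MemLp f 2 (volume.restrict (Ioo 0 ℓ)) ∧
      ∃ g : ℝ → ℝ, HasWeakDeriv ℓ f g ∧ MemSobolev ℓ k g

/-! ## Metric graphs -/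

/-- A compact connected metric graph: a finite connected discrete graph (parallel edges and loops
are allowed) with a length assigned to each edge. The edge `e`, identified with `[0, length e]`,
originates at `o e` and terminates at `t e`. -/
structure MetricGraph where
  /-- the vertices -/
  V : Type
  /-- the edges -/
  E : Type
  [fintypeV : Fintype V]
  [fintypeE : Fintype E]
  [nonemptyV : Nonempty V]
  /-- the originating vertex of an edge -/
  o : E → V
  /-- the terminating vertex of an edge -/
  t : E → V
  /-- the length of an edge -/
  length : E → ℝ
  length_pos : ∀ e, 0 < length e
  connected : ∀ v w : V,
    Relation.ReflTransGen (fun a b => ∃ e, (o e = a ∧ t e = b) ∨ (o e = b ∧ t e = a)) v w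

attribute [instance] MetricGraph.fintypeV MetricGraph.fintypeE MetricGraph.nonemptyV

namespace MetricGraph

/-- The identifications that make up the metric graph: the zero endpoint of `[0, length e]` is
glued to the vertex `o e`, and the other endpoint is glued to `t e`. -/
inductive Glue (Γ : MetricGraph) :
    (Γ.V ⊕ (Σ e : Γ.E, Icc (0 : ℝ) (Γ.length e))) →
      (Γ.V ⊕ (Σ e : Γ.E, Icc (0 : ℝ) (Γ.length e))) → Prop
  | origin (e : Γ.E) :
      Glue Γ (Sum.inr ⟨e, ⟨0, left_mem_Icc.2 (Γ.length_pos e).le⟩⟩) (Sum.inl (Γ.o e))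
  | terminus (e : Γ.E) :
      Glue Γ (Sum.inr ⟨e, ⟨Γ.length e, right_mem_Icc.2 (Γ.length_pos e).le⟩⟩) (Sum.inl (Γ.t e))

/-- The points of the metric graph. -/
def Point (Γ : MetricGraph) : Type := Quot Γ.Glue

/-- A vertex as a point of the metric graph. -/
def vertex (Γ : MetricGraph) (v : Γ.V) : Γ.Point := Quot.mk _ (Sum.inl v)

/-- The point of the edge `e` with coordinate `s ∈ [0, length e]`. -/
def onEdge (Γ : MetricGraph) (e : Γ.E) (s : Icc (0 : ℝ) (Γ.length e)) : Γ.Point :=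
  Quot.mk _ (Sum.inr ⟨e, s⟩)

/-- `Γ.IsPath x y r`: some path from `x` to `y`, composed of finitely many segments each of which
lies in one edge, has total length `r`. -/
inductive IsPath (Γ : MetricGraph) : Γ.Point → Γ.Point → ℝ → Prop
  | refl (x : Γ.Point) : IsPath Γ x x 0
  | segment (e : Γ.E) (s s' : Icc (0 : ℝ) (Γ.length e)) (y : Γ.Point) (r : ℝ)
      (h : IsPath Γ (Γ.onEdge e s') y r) :
      IsPath Γ (Γ.onEdge e s) y (|(s : ℝ) - (s' : ℝ)| + r)

/-- The distance of two points of the metric graph: the infimum of the lengths of the paths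
between them. (By connectedness there is such a path, see `exists_isPath`.) -/
def dist (Γ : MetricGraph) (x y : Γ.Point) : ℝ := sInf {r : ℝ | Γ.IsPath x y r}

/-- The open ball `B_ε(x)`. -/
def ball (Γ : MetricGraph) (x : Γ.Point) (ε : ℝ) : Set Γ.Point := {y | Γ.dist x y < ε}

theorem onEdge_zero (Γ : MetricGraph) (e : Γ.E) :
    Γ.onEdge e ⟨0, left_mem_Icc.2 (Γ.length_pos e).le⟩ = Γ.vertex (Γ.o e) :=
  Quot.sound (Glue.origin e)

theorem onEdge_length (Γ : MetricGraph) (e : Γ.E) :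
    Γ.onEdge e ⟨Γ.length e, right_mem_Icc.2 (Γ.length_pos e).le⟩ = Γ.vertex (Γ.t e) :=
  Quot.sound (Glue.terminus e)

theorem IsPath.trans {Γ : MetricGraph} {x y z : Γ.Point} {r s : ℝ} (h : Γ.IsPath x y r)
    (h' : Γ.IsPath y z s) : Γ.IsPath x z (r + s) := by
  induction h with
  | refl x => simpa using h'
  | segment e a b y r _ ih =>
    rw [add_assoc]
    exact IsPath.segment e a b z _ (ih h')

theorem IsPath.nonneg {Γ : MetricGraph} {x y : Γ.Point} {r : ℝ} (h : Γ.IsPath x y r) :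
    0 ≤ r := by
  induction h with
  | refl x => exact le_rfl
  | segment e a b y r _ ih => positivity

/-- Any two points of a metric graph are joined by a path, so the infimum that defines the distance
is one over a non-empty set of non-negative numbers. -/
theorem exists_isPath (Γ : MetricGraph) (x y : Γ.Point) : ∃ r, Γ.IsPath x y r := by
  have seg : ∀ (e : Γ.E) (s s' : Icc (0 : ℝ) (Γ.length e)),
      ∃ r, Γ.IsPath (Γ.onEdge e s) (Γ.onEdge e s') r :=
    fun e s s' => ⟨_, IsPath.segment e s s' _ 0 (IsPath.refl _)⟩
  have hv : ∀ v w : Γ.V, ∃ r, Γ.IsPath (Γ.vertex v) (Γ.vertex w) r := by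
    intro v w
    induction Γ.connected v w with
    | refl => exact ⟨0, IsPath.refl _⟩
    | tail _ hstep ih =>
      obtain ⟨r, hr⟩ := ih
      obtain ⟨e, ⟨rfl, rfl⟩ | ⟨rfl, rfl⟩⟩ := hstep
      · obtain ⟨r', hr'⟩ := seg e ⟨0, left_mem_Icc.2 (Γ.length_pos e).le⟩
          ⟨Γ.length e, right_mem_Icc.2 (Γ.length_pos e).le⟩
        rw [onEdge_zero, onEdge_length] at hr'
        exact ⟨_, hr.trans hr'⟩
      · obtain ⟨r', hr'⟩ := seg e ⟨Γ.length e, right_mem_Icc.2 (Γ.length_pos e).le⟩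
          ⟨0, left_mem_Icc.2 (Γ.length_pos e).le⟩
        rw [onEdge_zero, onEdge_length] at hr'
        exact ⟨_, hr.trans hr'⟩
  have hx : ∀ x : Γ.Point, ∃ v r r', Γ.IsPath x (Γ.vertex v) r ∧ Γ.IsPath (Γ.vertex v) x r' := by
    intro x
    induction x using Quot.ind with
    | mk a =>
      rcases a with v | ⟨e, s⟩
      · exact ⟨v, 0, 0, IsPath.refl _, IsPath.refl _⟩
      · obtain ⟨r, hr⟩ := seg e s ⟨0, left_mem_Icc.2 (Γ.length_pos e).le⟩
        obtain ⟨r', hr'⟩ := seg e ⟨0, left_mem_Icc.2 (Γ.length_pos e).le⟩ s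
        rw [onEdge_zero] at hr hr'
        exact ⟨Γ.o e, r, r', hr, hr'⟩
  obtain ⟨v, r₁, _, h₁, _⟩ := hx x
  obtain ⟨w, _, r₂, _, h₂⟩ := hx y
  obtain ⟨r, h⟩ := hv v w
  exact ⟨_, (h₁.trans h).trans h₂⟩

/-! ## The Laplacian with continuity and Kirchhoff vertex conditions -/

/-- The restriction `f_e` of a function on the metric graph to the edge `e`, a function on
`[0, length e]` (continued to `ℝ` by its values at the endpoints; only the values on
`[0, length e]` matter below). -/
def restr (Γ : MetricGraph) (f : Γ.Point → ℝ) (e : Γ.E) : ℝ → ℝ :=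
  IccExtend (Γ.length_pos e).le (fun s => f (Γ.onEdge e s))

open Classical in
/-- The sum `∂_ν f (v)` of the derivatives of `f` at the vertex `v`, each in the direction pointing
towards `v`, on all edges incident to `v`. The derivatives are the one-sided ones, of functions
on `[0, length e]`. -/
def normalDeriv (Γ : MetricGraph) (f : Γ.Point → ℝ) (v : Γ.V) : ℝ :=
  (∑ e : Γ.E, if Γ.t e = v then
      derivWithin (Γ.restr f e) (Icc 0 (Γ.length e)) (Γ.length e) else 0) -
    ∑ e : Γ.E, if Γ.o e = v then derivWithin (Γ.restr f e) (Icc 0 (Γ.length e)) 0 else 0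

/-- `f ∈ C(Γ)`: `f` is continuous on each edge. That its value at a vertex does not depend on the
incident edge is built into `Γ.Point`. -/
def MemC (Γ : MetricGraph) (f : Γ.Point → ℝ) : Prop :=
  ∀ e, ContinuousOn (Γ.restr f e) (Icc 0 (Γ.length e))

/-- `f` belongs to the domain of the Laplacian with standard vertex conditions: `f` is in
`H¹(Γ)`, all its restrictions to edges are in `H²`, and it satisfies the Kirchhoff condition at
every vertex. -/
def MemDomain (Γ : MetricGraph) (f : Γ.Point → ℝ) : Prop :=
  (Γ.MemC f ∧ ∀ e, MemSobolev (Γ.length e) 1 (Γ.restr f e)) ∧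
    (∀ e, MemSobolev (Γ.length e) 2 (Γ.restr f e)) ∧
    ∀ v, Γ.normalDeriv f v = 0

/-- `ψ` is a (real) eigenfunction of `-Δ` to the eigenvalue `μ`: a non-zero function in the domain
with `-ψ_e'' = μ ψ_e` in `L²` on each edge `e`. -/
def IsEigenfunction (Γ : MetricGraph) (μ : ℝ) (ψ : Γ.Point → ℝ) : Prop :=
  ψ ≠ 0 ∧ Γ.MemDomain ψ ∧
    ∀ e, ∃ g h : ℝ → ℝ, HasWeakDeriv (Γ.length e) (Γ.restr ψ e) g ∧ HasWeakDeriv (Γ.length e) g h ∧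
      ∀ᵐ x ∂(volume.restrict (Ioo 0 (Γ.length e))), -h x = μ * Γ.restr ψ e x

/-- The smallest positive eigenvalue `μ₂(Γ)` of `-Δ`. -/
def mu₂ (Γ : MetricGraph) : ℝ := sInf {μ : ℝ | 0 < μ ∧ ∃ ψ, Γ.IsEigenfunction μ ψ}

/-! ## Hot spots -/

/-- The set `M` of global hot spots: the points where some eigenfunction to `μ₂(Γ)` attains its
global maximum. -/
def M (Γ : MetricGraph) : Set Γ.Point :=
  {x | ∃ ψ, Γ.IsEigenfunction Γ.mu₂ ψ ∧ ∀ y, ψ y ≤ ψ x}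

/-- The set `M_loc` of local hot spots: the points where some eigenfunction to `μ₂(Γ)` attains a
non-zero local maximum. -/
def MLoc (Γ : MetricGraph) : Set Γ.Point :=
  {x | ∃ ψ, Γ.IsEigenfunction Γ.mu₂ ψ ∧ ψ x ≠ 0 ∧ ∃ ε > 0, ∀ y ∈ Γ.ball x ε, ψ y ≤ ψ x}

/-! ## Stars -/

/-- `Γ` is a star with `n` edges, all of them oriented away from the star vertex: one edge has
length `a`, and the other `n - 1` edges have length `b`. -/
def IsStarWith (Γ : MetricGraph) (n : ℕ) (a b : ℝ) : Prop :=
  Fintype.card Γ.E = n ∧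
  (∃ v₀ : Γ.V, (∀ e, Γ.o e = v₀) ∧ (∀ e, Γ.t e ≠ v₀) ∧ Function.Injective Γ.t ∧
    ∀ v, v ≠ v₀ → ∃ e, Γ.t e = v) ∧
  ∃ e₀ : Γ.E, Γ.length e₀ = a ∧ ∀ e, e ≠ e₀ → Γ.length e = b

end MetricGraph

end

/-! Take `ε = 1/2` and `m = n - 1` short edges. The leaf condition makes an eigenfunction for `k ^
2` equal to `A e * cos (k (ℓ - s))` on each edge, where `s` is measured from the star vertex. If `0
< k < π`, continuity at the star vertex gives every short edge the amplitude `cos k / cos (k/2)`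
times that of the long edge, and Kirchhoff's condition there becomes `1 + (m + 1) cos k = 0`
(`secular`). So `k = arccos (-1/(m+1))` gives `μ₂`, with a one-dimensional eigenspace.

At this `k` one has `cos k < 0 < cos (k/2)`: the long amplitude and the common short amplitude have
opposite signs. One sign of the eigenfunction has its maximum at the long leaf, the other at all
short leaves at once; thus all `n` leaves lie in `M`. Conversely, since `k ℓ ≤ π`, the function
increases strictly towards the leaf on an edge of positive amplitude and decreases strictly on one
of negative amplitude. The star vertex lies on an edge of positive amplitude, so only leaves can be
local maxima.

As eigenfunctions are defined through weak derivatives, regularity has to come first: du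
Bois-Reymond's lemma turns weak solutions into classical ones
(`exists_eqOn_cos_sin_of_hasWeakDeriv`). -/

noncomputable section

/-! ### Weak derivatives on an interval and regularity of weak solutions -/

/-- A smooth function with compact support in `(0, ℓ)` and mean zero is the derivative of a
function of the same kind. -/
theorem exists_deriv_eq_of_integral_eq_zero {ℓ : ℝ} (hℓ : 0 < ℓ) {φ : ℝ → ℝ}
    (hφ : ContDiff ℝ ∞ φ) (hc : HasCompactSupport φ) (hs : tsupport φ ⊆ Ioo 0 ℓ)
    (h0 : ∫ x in Ioo 0 ℓ, φ x = 0) :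
    ∃ Φ : ℝ → ℝ, ContDiff ℝ ∞ Φ ∧ HasCompactSupport Φ ∧ tsupport Φ ⊆ Ioo 0 ℓ ∧ deriv Φ = φ := by
  have hcont : Continuous φ := hφ.continuous
  have hd : ∀ x, HasDerivAt (fun x => ∫ t in (0 : ℝ)..x, φ t) (φ x) x := fun x =>
    intervalIntegral.integral_hasDerivAt_right (hcont.intervalIntegrable _ _)
      (hcont.stronglyMeasurableAtFilter _ _) hcont.continuousAt
  obtain ⟨a, b, ha, hb, hab⟩ : ∃ a b, 0 < a ∧ b < ℓ ∧ tsupport φ ⊆ Icc a b := by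
    rcases (tsupport φ).eq_empty_or_nonempty with he | hne
    -- For empty support any admissible pair will do.
    · exact ⟨ℓ, 0, hℓ, hℓ, by simp [he]⟩
    · have hK : IsCompact (tsupport φ) := hc
      obtain ⟨a, ha, ha'⟩ := hK.exists_isLeast hne
      obtain ⟨b, hb, hb'⟩ := hK.exists_isGreatest hne
      exact ⟨a, b, (hs ha).1, (hs hb).2, fun x hx => ⟨ha' hx, hb' hx⟩⟩
  have hz : ∀ x, x ∉ Icc a b → φ x = 0 := fun x hx =>
    image_eq_zero_of_notMem_tsupport fun h => hx (hab h)
  have hsupp : tsupport (fun x => ∫ t in (0 : ℝ)..x, φ t) ⊆ Icc a b := by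
    refine closure_minimal (fun x hx => ?_) isClosed_Icc
    by_contra hxab
    apply hx
    rw [mem_Icc, not_and_or, not_le, not_le] at hxab
    rcases hxab with hxa | hxb
    · refine intervalIntegral.integral_zero_ae (Filter.Eventually.of_forall fun t ht => hz t ?_)
      have : t ≤ max 0 x := ht.2
      intro h
      have := h.1
      rcases max_cases 0 x with h' | h' <;> linarith
    -- To the right of the support, the primitive equals the full integral over `(0, ℓ)`, which is
    -- zero by assumption.
    · have h1 : ∫ t in (0 : ℝ)..ℓ, φ t = 0 := by
        rw [intervalIntegral.integral_of_le hℓ.le, integral_Ioc_eq_integral_Ioo, h0]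
      have h2 : ∫ t in x..ℓ, φ t = 0 := by
        refine intervalIntegral.integral_zero_ae (Filter.Eventually.of_forall fun t ht => hz t ?_)
        have : min x ℓ < t := ht.1
        intro h
        have := h.2
        rcases min_cases x ℓ with h' | h' <;> linarith
      have h3 := intervalIntegral.integral_add_adjacent_intervals
        (hcont.intervalIntegrable 0 x) (hcont.intervalIntegrable (μ := volume) x ℓ)
      simp only [h1, h2, add_zero] at h3
      exact h3
  refine ⟨fun x => ∫ t in (0 : ℝ)..x, φ t, ?_, ?_, ?_, ?_⟩
  · rw [contDiff_infty_iff_deriv]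
    refine ⟨fun x => (hd x).differentiableAt, ?_⟩
    rwa [show deriv (fun x => ∫ t in (0 : ℝ)..x, φ t) = φ from funext fun x => (hd x).deriv]
  · exact HasCompactSupport.of_support_subset_isCompact isCompact_Icc
      (subset_closure.trans hsupp)
  · exact hsupp.trans fun x hx => ⟨ha.trans_le hx.1, hx.2.trans_lt hb⟩
  · exact funext fun x => (hd x).deriv

/-- A locally integrable function times a compactly supported continuous one is integrable. -/
theorem LocallyIntegrableOn.integrableOn_mul_of_tsupport_subset {U : Set ℝ} (hU : IsOpen U)
    {u φ : ℝ → ℝ} (hu : LocallyIntegrableOn u U) (hφ : Continuous φ)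
    (hc : HasCompactSupport φ) (hs : tsupport φ ⊆ U) :
    IntegrableOn (fun x => u x * φ x) U := by
  have h1 : IntegrableOn (fun x => u x * φ x) (tsupport φ) :=
    (hu.integrableOn_compact_subset hs hc).mul_continuousOn hφ.continuousOn hc
  refine IntegrableOn.of_forall_sdiff_eq_zero h1 hU.measurableSet fun x hx => ?_
  rw [image_eq_zero_of_notMem_tsupport hx.2, mul_zero]

/-- The lemma of du Bois-Reymond. -/
theorem exists_ae_eq_const_of_integral_mul_deriv_eq_zero {ℓ : ℝ} (hℓ : 0 < ℓ) {u : ℝ → ℝ}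
    (hu : LocallyIntegrableOn u (Ioo 0 ℓ))
    (h : ∀ φ : ℝ → ℝ, ContDiff ℝ ∞ φ → HasCompactSupport φ → tsupport φ ⊆ Ioo 0 ℓ →
      ∫ x in Ioo 0 ℓ, u x * deriv φ x = 0) :
    ∃ c : ℝ, ∀ᵐ x ∂(volume.restrict (Ioo 0 ℓ)), u x = c := by
  obtain ⟨ρ, hρs, hρc, hρ, hρi⟩ : ∃ ρ : ℝ → ℝ, tsupport ρ ⊆ Ioo 0 ℓ ∧ HasCompactSupport ρ ∧
      ContDiff ℝ ∞ ρ ∧ ∫ x in Ioo 0 ℓ, ρ x = 1 := by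
    let B : ContDiffBump (ℓ / 2) := ⟨ℓ / 8, ℓ / 4, by positivity, by linarith⟩
    have hsub : tsupport (B.normed volume) ⊆ Ioo 0 ℓ := by
      rw [B.tsupport_normed_eq, Real.closedBall_eq_Icc]
      intro x hx
      have h1 : ℓ / 2 - ℓ / 4 ≤ x := hx.1
      have h2 : x ≤ ℓ / 2 + ℓ / 4 := hx.2
      constructor <;> linarith
    refine ⟨B.normed volume, hsub, B.hasCompactSupport_normed, B.contDiff_normed, ?_⟩
    rw [setIntegral_eq_integral_of_forall_compl_eq_zero, B.integral_normed]
    exact fun x hx => image_eq_zero_of_notMem_tsupport fun h => hx (hsub h)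
  refine ⟨∫ x in Ioo 0 ℓ, u x * ρ x, ?_⟩
  set c := ∫ x in Ioo 0 ℓ, u x * ρ x
  -- Subtracting the multiple of `ρ` with the same integral leaves a mean-zero test function, hence
  -- a derivative `Φ'`, to which `h` applies.
  have key : ∀ φ : ℝ → ℝ, ContDiff ℝ ∞ φ → HasCompactSupport φ → tsupport φ ⊆ Ioo 0 ℓ →
      ∫ x, φ x • (u x - c) = 0 := by
    intro φ hφ hc hs
    have hφi : IntegrableOn φ (Ioo 0 ℓ) := (hφ.continuous.integrable_of_hasCompactSupport hc).integrableOn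
    have hρi' : IntegrableOn ρ (Ioo 0 ℓ) := (hρ.continuous.integrable_of_hasCompactSupport hρc).integrableOn
    set I := ∫ x in Ioo 0 ℓ, φ x with hI
    have hts : tsupport (fun x => φ x - I * ρ x) ⊆ tsupport φ ∪ tsupport ρ := by
      refine closure_minimal (fun x hx => ?_) ((isClosed_tsupport _).union (isClosed_tsupport _))
      by_contra hx'
      rw [mem_union, not_or] at hx'
      apply hx
      simp [image_eq_zero_of_notMem_tsupport hx'.1, image_eq_zero_of_notMem_tsupport hx'.2]
    obtain ⟨Φ, h1, h2, h3, h4⟩ := exists_deriv_eq_of_integral_eq_zero hℓ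
      (φ := fun x => φ x - I * ρ x) (hφ.sub (contDiff_const.mul hρ))
      ((IsCompact.union hc hρc).of_isClosed_subset (isClosed_tsupport _) hts)
      (hts.trans (union_subset hs hρs))
      (by rw [integral_sub hφi (hρi'.const_mul I), integral_const_mul, hρi, mul_one, sub_self])
    have h5 := h Φ h1 h2 h3
    rw [h4] at h5
    have iφ := LocallyIntegrableOn.integrableOn_mul_of_tsupport_subset isOpen_Ioo hu hφ.continuous hc hs
    have iρ := LocallyIntegrableOn.integrableOn_mul_of_tsupport_subset isOpen_Ioo hu hρ.continuous hρc hρs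
    have h6 : ∫ x in Ioo 0 ℓ, u x * φ x = I * c := by
      have : (fun x => u x * (φ x - I * ρ x)) = fun x => u x * φ x - I * (u x * ρ x) := by
        ext x; ring
      rw [this, integral_sub iφ (iρ.const_mul I), integral_const_mul] at h5
      linarith
    rw [← setIntegral_eq_integral_of_forall_compl_eq_zero (s := Ioo 0 ℓ)]
    · have : (fun x => φ x • (u x - c)) = fun x => u x * φ x - φ x * c := by
        ext x; simp only [smul_eq_mul]; ring
      rw [this, integral_sub iφ (hφi.mul_const c), integral_mul_const, h6, ← hI, sub_self]
    · intro x hx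
      rw [image_eq_zero_of_notMem_tsupport fun h => hx (hs h), zero_smul]
  have hloc : LocallyIntegrableOn (fun x => u x - c) (Ioo 0 ℓ) :=
    hu.sub ((locallyIntegrable_const c).locallyIntegrableOn _)
  have := isOpen_Ioo.ae_eq_zero_of_integral_contDiff_smul_eq_zero hloc key
  rw [ae_restrict_iff' measurableSet_Ioo]
  filter_upwards [this] with x hx hxI
  linarith [hx hxI]

/-- Integration by parts against a test function. -/
theorem setIntegral_mul_deriv_eq_neg {ℓ : ℝ} (hℓ : 0 < ℓ) {F F' φ : ℝ → ℝ}
    (hF : ∀ x, HasDerivAt F (F' x) x) (hF' : Continuous F')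
    (hφ : ContDiff ℝ ∞ φ) (hs : tsupport φ ⊆ Ioo 0 ℓ) :
    ∫ x in Ioo 0 ℓ, F x * deriv φ x = -∫ x in Ioo 0 ℓ, F' x * φ x := by
  have h0 : φ 0 = 0 := image_eq_zero_of_notMem_tsupport fun h => lt_irrefl _ (hs h).1
  have h1 : φ ℓ = 0 := image_eq_zero_of_notMem_tsupport fun h => lt_irrefl _ (hs h).2
  have := intervalIntegral.integral_mul_deriv_eq_deriv_mul (a := 0) (b := ℓ) (u := F) (u' := F')
    (v := φ) (v' := deriv φ) (fun x _ => hF x)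
    (fun x _ => (hφ.differentiable (by simp) x).hasDerivAt)
    (hF'.intervalIntegrable _ _) ((hφ.continuous_deriv (by simp)).intervalIntegrable _ _)
  rw [intervalIntegral.integral_of_le hℓ.le, intervalIntegral.integral_of_le hℓ.le,
    integral_Ioc_eq_integral_Ioo, integral_Ioc_eq_integral_Ioo, h0, h1] at this
  rw [this]; ring

/-- A function that agrees on `(0, ℓ)` with a continuously differentiable one has the classical
derivative as its weak derivative. -/
theorem HasWeakDeriv.of_hasDerivAt {ℓ : ℝ} (hℓ : 0 < ℓ) {f F F' : ℝ → ℝ}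
    (hfF : EqOn f F (Ioo 0 ℓ)) (hF : ∀ x, HasDerivAt F (F' x) x) (hF' : Continuous F') :
    HasWeakDeriv ℓ f F' := by
  have hFc : Continuous F := continuous_iff_continuousAt.2 fun x => (hF x).continuousAt
  refine ⟨(hFc.continuousOn.congr hfF).locallyIntegrableOn measurableSet_Ioo,
    hF'.locallyIntegrable.locallyIntegrableOn _, fun φ hφ _ hs => ?_⟩
  rw [← setIntegral_mul_deriv_eq_neg hℓ hF hF' hφ hs]
  exact setIntegral_congr_fun measurableSet_Ioo fun x hx => by simp only [hfF hx]

/-- A function with a continuous weak derivative is, up to a constant, a primitive of it. -/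
theorem HasWeakDeriv.exists_ae_eq_primitive {ℓ : ℝ} (hℓ : 0 < ℓ) {f g G : ℝ → ℝ}
    (h : HasWeakDeriv ℓ f g) (hG : Continuous G)
    (hgG : ∀ᵐ x ∂(volume.restrict (Ioo 0 ℓ)), g x = G x) :
    ∃ F : ℝ → ℝ, (∀ x, HasDerivAt F (G x) x) ∧
      ∀ᵐ x ∂(volume.restrict (Ioo 0 ℓ)), f x = F x := by
  obtain ⟨hf, hg, h⟩ := h
  have hd : ∀ x, HasDerivAt (fun x => ∫ t in (0 : ℝ)..x, G t) (G x) x := fun x =>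
    intervalIntegral.integral_hasDerivAt_right (hG.intervalIntegrable _ _)
      (hG.stronglyMeasurableAtFilter _ _) hG.continuousAt
  have hFc : Continuous (fun x => ∫ t in (0 : ℝ)..x, G t) :=
    continuous_iff_continuousAt.2 fun x => (hd x).continuousAt
  have hF : LocallyIntegrableOn (fun x => ∫ t in (0 : ℝ)..x, G t) (Ioo 0 ℓ) :=
    hFc.locallyIntegrable.locallyIntegrableOn _
  obtain ⟨c, hc⟩ := exists_ae_eq_const_of_integral_mul_deriv_eq_zero hℓ (hf.sub hF) (by
    intro φ hφ hφc hs
    have hs' : tsupport (deriv φ) ⊆ Ioo 0 ℓ :=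
      (closure_minimal (support_deriv_subset) (isClosed_tsupport _)).trans hs
    have hcd := hφ.continuous_deriv (by simp)
    have i1 := LocallyIntegrableOn.integrableOn_mul_of_tsupport_subset isOpen_Ioo hf hcd hφc.deriv hs'
    have i2 := LocallyIntegrableOn.integrableOn_mul_of_tsupport_subset isOpen_Ioo hF hcd hφc.deriv hs'
    simp only [Pi.sub_apply, sub_mul]
    rw [integral_sub i1 i2, h φ hφ hφc hs, setIntegral_mul_deriv_eq_neg hℓ hd hG hφ hs, sub_neg_eq_add,
      neg_add_eq_zero]
    refine integral_congr_ae ?_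
    filter_upwards [hgG] with x hx
    rw [hx])
  refine ⟨fun x => (∫ t in (0 : ℝ)..x, G t) + c, fun x => (hd x).add_const c, ?_⟩
  filter_upwards [hc] with x hx
  simp only [Pi.sub_apply] at hx
  linarith

/-- Weak solutions of `-f'' = k² f` are combinations of cosines and sines. -/
theorem exists_eqOn_cos_sin_of_hasWeakDeriv {ℓ k : ℝ} (hℓ : 0 < ℓ) (hk : 0 < k) {f g h : ℝ → ℝ}
    (hf : Continuous f) (hfg : HasWeakDeriv ℓ f g) (hgh : HasWeakDeriv ℓ g h)
    (hh : ∀ᵐ x ∂(volume.restrict (Ioo 0 ℓ)), -h x = k ^ 2 * f x) :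
    ∃ a b : ℝ, EqOn f (fun x => a * Real.cos (k * (ℓ - x)) + b * Real.sin (k * (ℓ - x)))
      (Icc 0 ℓ) := by
  -- Bootstrapping: `h` agrees a.e. with the continuous function `-k² f`, so `g` agrees a.e. with a
  -- `C¹` function `G`, and `f` with a `C²` function `F`.
  obtain ⟨G, hG, hgG⟩ := hgh.exists_ae_eq_primitive hℓ (G := fun x => -(k ^ 2 * f x)) (by fun_prop)
    (by filter_upwards [hh] with x hx; linarith)
  have hGc : Continuous G := continuous_iff_continuousAt.2 fun x => (hG x).continuousAt
  obtain ⟨F, hF, hfF⟩ := hfg.exists_ae_eq_primitive hℓ hGc hgG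
  have hFc : Continuous F := continuous_iff_continuousAt.2 fun x => (hF x).continuousAt
  have hIoo : EqOn f F (Ioo 0 ℓ) :=
    Measure.eqOn_open_of_ae_eq hfF isOpen_Ioo hf.continuousOn hFc.continuousOn
  have hIcc : EqOn f F (Icc 0 ℓ) := by
    have := hIoo.closure hf hFc
    rwa [closure_Ioo hℓ.ne] at this
  have hc : ∀ x, HasDerivAt (fun x => Real.cos (k * (ℓ - x))) (k * Real.sin (k * (ℓ - x))) x := by
    intro x
    have h1 : HasDerivAt (fun x => k * (ℓ - x)) (-k) x := by
      simpa using ((hasDerivAt_id x).const_sub ℓ).const_mul k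
    convert h1.cos using 1; ring
  have hs : ∀ x, HasDerivAt (fun x => Real.sin (k * (ℓ - x))) (-(k * Real.cos (k * (ℓ - x)))) x := by
    intro x
    have h1 : HasDerivAt (fun x => k * (ℓ - x)) (-k) x := by
      simpa using ((hasDerivAt_id x).const_sub ℓ).const_mul k
    convert h1.sin using 1; ring
  have const : ∀ P : ℝ → ℝ, (∀ x ∈ Icc 0 ℓ, HasDerivAt P 0 x) → ∀ x ∈ Icc 0 ℓ, P x = P 0 :=
    fun P hP => constant_of_has_deriv_right_zero
      (fun x hx => (hP x hx).continuousAt.continuousWithinAt)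
      (fun x hx => (hP x (Ico_subset_Icc_self hx)).hasDerivWithinAt)
  -- `(k F, G)` moves by a rotation under `F' = G`, `G' = -k² F`; undoing that rotation gives two
  -- conserved quantities, which are `k` times the coefficients sought.
  have hP := const (fun x => k * F x * Real.cos (k * (ℓ - x)) + G x * Real.sin (k * (ℓ - x)))
    (fun x hx => by
      refine ((((hF x).const_mul k).mul (hc x)).add ((hG x).mul (hs x))).congr_deriv ?_
      rw [hIcc hx]; ring)
  have hQ := const (fun x => k * F x * Real.sin (k * (ℓ - x)) - G x * Real.cos (k * (ℓ - x)))
    (fun x hx => by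
      refine ((((hF x).const_mul k).mul (hs x)).sub ((hG x).mul (hc x))).congr_deriv ?_
      rw [hIcc hx]; ring)
  refine ⟨(k * F 0 * Real.cos (k * (ℓ - 0)) + G 0 * Real.sin (k * (ℓ - 0))) / k,
    (k * F 0 * Real.sin (k * (ℓ - 0)) - G 0 * Real.cos (k * (ℓ - 0))) / k, fun x hx => ?_⟩
  have h1 := hP x hx
  have h2 := hQ x hx
  simp only at h1 h2 ⊢
  rw [← h1, ← h2, hIcc hx]
  field_simp
  linear_combination -(k * F x) * Real.sin_sq_add_cos_sq (k * (ℓ - x))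

/-- A function that agrees on `(0, ℓ)` with a smooth one belongs to all Sobolev spaces. -/
theorem MemSobolev.of_contDiff {ℓ : ℝ} (hℓ : 0 < ℓ) (n : ℕ) {f F : ℝ → ℝ}
    (hfF : EqOn f F (Ioo 0 ℓ)) (hF : ContDiff ℝ ∞ F) : MemSobolev ℓ n f := by
  have hL : ∀ {f F : ℝ → ℝ}, EqOn f F (Ioo 0 ℓ) → Continuous F →
      MemLp f 2 (volume.restrict (Ioo 0 ℓ)) := by
    intro f F hfF hF
    obtain ⟨C, hC⟩ := isCompact_Icc.exists_bound_of_continuousOn (s := Icc 0 ℓ) hF.continuousOn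
    have h1 : MemLp F 2 (volume.restrict (Ioo 0 ℓ)) := by
      refine MemLp.of_bound hF.aestronglyMeasurable C ?_
      filter_upwards [ae_restrict_mem measurableSet_Ioo] with x hx
      exact hC x (Ioo_subset_Icc_self hx)
    refine h1.ae_eq ?_
    filter_upwards [ae_restrict_mem measurableSet_Ioo] with x hx using (hfF hx).symm
  induction n generalizing f F with
  | zero => exact hL hfF hF.continuous
  | succ n ih =>
    have hd := (contDiff_infty_iff_deriv.1 hF)
    exact ⟨hL hfF hF.continuous, deriv F,
      HasWeakDeriv.of_hasDerivAt hℓ hfF (fun x => (hd.1 x).hasDerivAt) hd.2.continuous,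
      ih (fun _ _ => rfl) hd.2⟩


/-! ### Functions on a metric graph and monotonicity along an edge -/

namespace MetricGraph

theorem restr_of_mem (Γ : MetricGraph) (f : Γ.Point → ℝ) (e : Γ.E) {x : ℝ}
    (hx : x ∈ Icc 0 (Γ.length e)) : Γ.restr f e x = f (Γ.onEdge e ⟨x, hx⟩) :=
  IccExtend_of_mem _ _ hx

/-- The extension beyond the edge is by endpoint values, so it factors through the continuous
projection onto `[0, length e]`. -/
theorem MemC.continuous_restr {Γ : MetricGraph} {f : Γ.Point → ℝ} (hf : Γ.MemC f) (e : Γ.E) :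
    Continuous (Γ.restr f e) := by
  have h : Γ.restr f e = fun x => Γ.restr f e (projIcc 0 _ (Γ.length_pos e).le x) := by
    ext x
    rw [restr_of_mem Γ f e (projIcc 0 _ (Γ.length_pos e).le x).2]
    rfl
  rw [h]
  exact (hf e).comp_continuous (continuous_subtype_val.comp continuous_projIcc) fun x =>
    (projIcc 0 _ (Γ.length_pos e).le x).2

theorem dist_onEdge_le (Γ : MetricGraph) (e : Γ.E) (s s' : Icc (0 : ℝ) (Γ.length e)) :
    Γ.dist (Γ.onEdge e s) (Γ.onEdge e s') ≤ |(s : ℝ) - s'| := by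
  refine csInf_le ⟨0, fun r hr => IsPath.nonneg hr⟩ ?_
  have := IsPath.segment e s s' _ 0 (IsPath.refl (Γ.onEdge e s'))
  rwa [add_zero] at this

/-- The function with the given values on the vertices and on the edges. -/
def glueFun (Γ : MetricGraph) (F : Γ.E → ℝ → ℝ) (c : Γ.V → ℝ) (ho : ∀ e, F e 0 = c (Γ.o e))
    (ht : ∀ e, F e (Γ.length e) = c (Γ.t e)) : Γ.Point → ℝ :=
  Quot.lift (Sum.elim c fun p => F p.1 p.2) fun a b h => by
    cases h with
    | origin e => exact ho e
    | terminus e => exact ht e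

/-- Gluing does not merge distinct vertices, because some function on the quotient separates them.
This is what allows the leaves to be counted as points. -/
theorem vertex_injective (Γ : MetricGraph) : Function.Injective Γ.vertex := by
  classical
  intro v w hvw
  let c : Γ.V → ℝ := fun u => if u = v then 1 else 0
  -- Only the endpoint values have to match for the function to descend to the quotient, so a jump
  -- at `0` does no harm.
  let F : Γ.E → ℝ → ℝ := fun e x => if x = 0 then c (Γ.o e) else c (Γ.t e)
  have h := congrArg (Γ.glueFun F c (fun e => by simp [F])
    (fun e => by simp [F, (Γ.length_pos e).ne'])) hvw
  by_contra hne
  have h' : c v = c w := h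
  simp [c, Ne.symm hne] at h'

/-- If `f` is a positive multiple of `cos (k (ℓ - s))` on an edge of length `ℓ`, then it has no
local maximum there, with the possible exception of the terminal endpoint. -/
theorem exists_lt_of_pos_mul_cos (Γ : MetricGraph) {f : Γ.Point → ℝ} {e : Γ.E} {A k : ℝ}
    (hA : 0 < A) (hk : 0 < k) (hkl : k * Γ.length e ≤ Real.pi)
    (hf : ∀ s, f (Γ.onEdge e s) = A * Real.cos (k * (Γ.length e - s)))
    {s : Icc (0 : ℝ) (Γ.length e)} (hs : (s : ℝ) < Γ.length e) {ε : ℝ} (hε : 0 < ε) :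
    ∃ y ∈ Γ.ball (Γ.onEdge e s) ε, f (Γ.onEdge e s) < f y := by
  -- A point slightly nearer to the terminal endpoint: the argument of the cosine gets smaller but
  -- stays within `[0, π]`.
  obtain ⟨r, hr1, hr2⟩ := exists_between (lt_min hs (show (s : ℝ) < s + ε by linarith))
  obtain ⟨hr3, hr4⟩ := lt_min_iff.1 hr2
  have h0 := s.2.1
  refine ⟨Γ.onEdge e ⟨r, by linarith, hr3.le⟩, (Γ.dist_onEdge_le e _ _).trans_lt ?_, ?_⟩
  · rw [abs_sub_comm, abs_of_pos (by simpa using hr1)]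
    simp only
    linarith
  · rw [hf, hf]
    refine mul_lt_mul_of_pos_left (Real.cos_lt_cos_of_nonneg_of_le_pi ?_ ?_ ?_) hA
    · exact mul_nonneg hk.le (by simp only; linarith)
    · refine le_trans ?_ hkl
      exact mul_le_mul_of_nonneg_left (by linarith) hk.le
    · exact mul_lt_mul_of_pos_left (by simp only; linarith) hk

/-- If `f` is a negative multiple of `cos (k (ℓ - s))` on an edge of length `ℓ`, then it has no
local maximum there, with the possible exception of the original endpoint. -/
theorem exists_lt_of_neg_mul_cos (Γ : MetricGraph) {f : Γ.Point → ℝ} {e : Γ.E} {A k : ℝ}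
    (hA : A < 0) (hk : 0 < k) (hkl : k * Γ.length e ≤ Real.pi)
    (hf : ∀ s, f (Γ.onEdge e s) = A * Real.cos (k * (Γ.length e - s)))
    {s : Icc (0 : ℝ) (Γ.length e)} (hs : 0 < (s : ℝ)) {ε : ℝ} (hε : 0 < ε) :
    ∃ y ∈ Γ.ball (Γ.onEdge e s) ε, f (Γ.onEdge e s) < f y := by
  obtain ⟨r, hr1, hr2⟩ := exists_between (max_lt hs (show (s : ℝ) - ε < s by linarith))
  obtain ⟨hr3, hr4⟩ := max_lt_iff.1 hr1
  have h0 := s.2.2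
  refine ⟨Γ.onEdge e ⟨r, hr3.le, by linarith⟩, (Γ.dist_onEdge_le e _ _).trans_lt ?_, ?_⟩
  · rw [abs_of_pos (by simpa using hr2)]
    simp only
    linarith
  · rw [hf, hf]
    refine mul_lt_mul_of_neg_left (Real.cos_lt_cos_of_nonneg_of_le_pi ?_ ?_ ?_) hA
    · exact mul_nonneg hk.le (by linarith)
    · refine le_trans ?_ hkl
      exact mul_le_mul_of_nonneg_left (by simp only; linarith) hk.le
    · exact mul_lt_mul_of_pos_left (by simp only; linarith) hk

/-! ### The star graph and its vertex conditions -/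

/-- The star with one edge of length `1` and `m` edges of length `1 / 2`, oriented away from the
star vertex. -/
def starGraph (m : ℕ) : MetricGraph where
  V := Option (Option (Fin m))
  E := Option (Fin m)
  o _ := none
  t e := some e
  length e := e.elim 1 fun _ => 1 / 2
  length_pos e := by cases e <;> simp
  connected := by
    have h : ∀ v : Option (Option (Fin m)), Relation.ReflTransGen
        (fun a b : Option (Option (Fin m)) =>
          ∃ e : Option (Fin m), (none = a ∧ some e = b) ∨ (none = b ∧ some e = a)) v none ∧
        Relation.ReflTransGen
        (fun a b : Option (Option (Fin m)) =>
          ∃ e : Option (Fin m), (none = a ∧ some e = b) ∨ (none = b ∧ some e = a)) none v := by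
      intro v
      cases v with
      | none => exact ⟨.refl, .refl⟩
      | some e => exact ⟨.single ⟨e, .inr ⟨rfl, rfl⟩⟩, .single ⟨e, .inl ⟨rfl, rfl⟩⟩⟩
    exact fun v w => (h v).1.trans (h w).2

namespace starGraph

variable {m : ℕ}

/-- The star vertex. -/
def center (m : ℕ) : (starGraph m).V := (none : Option (Option (Fin m)))

/-- The edge of length `1`. -/
def long (m : ℕ) : (starGraph m).E := (none : Option (Fin m))

/-- The edges of length `1 / 2`. -/
def short (i : Fin m) : (starGraph m).E := (some i : Option (Fin m))

theorem edge_cases (e : (starGraph m).E) : e = long m ∨ ∃ i, e = short i := by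
  change Option (Fin m) at e
  cases e with
  | none => exact .inl rfl
  | some i => exact .inr ⟨i, rfl⟩

theorem vertex_cases (v : (starGraph m).V) : v = center m ∨ ∃ e, v = (starGraph m).t e := by
  change Option (Option (Fin m)) at v
  cases v with
  | none => exact .inl rfl
  | some e => exact .inr ⟨e, rfl⟩

theorem o_eq (e : (starGraph m).E) : (starGraph m).o e = center m := rfl

theorem t_ne_center (e : (starGraph m).E) : (starGraph m).t e ≠ center m := Option.some_ne_none _

theorem t_injective : Function.Injective (starGraph m).t := Option.some_injective _

theorem length_long : (starGraph m).length (long m) = 1 := rfl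

theorem length_short (i : Fin m) : (starGraph m).length (short i) = 1 / 2 := rfl

theorem length_le_one (e : (starGraph m).E) : (starGraph m).length e ≤ 1 := by
  obtain rfl | ⟨i, rfl⟩ := edge_cases e
  · exact length_long.le
  · rw [length_short]; norm_num

theorem card_edges : Fintype.card (starGraph m).E = m + 1 := by
  have : Fintype.card (Option (Fin m)) = m + 1 := by simp
  exact this

theorem sum_edges (f : (starGraph m).E → ℝ) :
    ∑ e, f e = f (long m) + ∑ i, f (short i) :=
  Fintype.sum_option f

theorem isStarWith (m : ℕ) : (starGraph m).IsStarWith (m + 1) 1 (1 / 2) := by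
  refine ⟨card_edges, ⟨center m, o_eq, t_ne_center, t_injective, fun v hv => ?_⟩,
    long m, length_long, fun e he => ?_⟩
  · obtain rfl | ⟨e, rfl⟩ := vertex_cases v
    · exact absurd rfl hv
    · exact ⟨e, rfl⟩
  · obtain rfl | ⟨i, rfl⟩ := edge_cases e
    · exact absurd rfl he
    · rfl

theorem exists_eq_onEdge (x : (starGraph m).Point) : ∃ e s, x = (starGraph m).onEdge e s := by
  induction x using Quot.ind with
  | mk a =>
    rcases a with v | ⟨e, s⟩
    · obtain rfl | ⟨e, rfl⟩ := vertex_cases v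
      · exact ⟨long m, _, ((starGraph m).onEdge_zero (long m)).symm⟩
      · exact ⟨e, _, ((starGraph m).onEdge_length e).symm⟩
    · exact ⟨e, s, rfl⟩

theorem normalDeriv_t (f : (starGraph m).Point → ℝ) (e : (starGraph m).E) :
    (starGraph m).normalDeriv f ((starGraph m).t e) =
      derivWithin ((starGraph m).restr f e) (Icc 0 ((starGraph m).length e))
        ((starGraph m).length e) := by
  rw [normalDeriv, Finset.sum_eq_single e, Finset.sum_eq_zero, if_pos rfl, sub_zero]
  · exact fun e' _ => if_neg fun h => t_ne_center e h.symm
  · exact fun e' _ he => if_neg fun h => he (t_injective h)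
  · exact fun h => absurd (Finset.mem_univ e) h

theorem normalDeriv_center (f : (starGraph m).Point → ℝ) :
    (starGraph m).normalDeriv f (center m) =
      -∑ e, derivWithin ((starGraph m).restr f e) (Icc 0 ((starGraph m).length e)) 0 := by
  rw [normalDeriv, Finset.sum_eq_zero, zero_sub]
  · exact congrArg _ (Finset.sum_congr rfl fun e _ => if_pos rfl)
  · exact fun e _ => if_neg (t_ne_center e)

/-! ### Eigenfunctions of the star as cosines on the edges -/

theorem hasDerivAt_cos_sin (a b k ℓ x : ℝ) :
    HasDerivAt (fun x => a * Real.cos (k * (ℓ - x)) + b * Real.sin (k * (ℓ - x)))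
      (k * (a * Real.sin (k * (ℓ - x)) - b * Real.cos (k * (ℓ - x)))) x := by
  have h1 : HasDerivAt (fun x => k * (ℓ - x)) (-k) x := by
    simpa using ((hasDerivAt_id x).const_sub ℓ).const_mul k
  refine ((h1.cos.const_mul a).add (h1.sin.const_mul b)).congr_deriv ?_
  ring

theorem derivWithin_of_eqOn_cos_sin {f : ℝ → ℝ} {a b k ℓ x : ℝ} (hℓ : 0 < ℓ)
    (hf : EqOn f (fun x => a * Real.cos (k * (ℓ - x)) + b * Real.sin (k * (ℓ - x))) (Icc 0 ℓ))
    (hx : x ∈ Icc 0 ℓ) :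
    derivWithin f (Icc 0 ℓ) x =
      k * (a * Real.sin (k * (ℓ - x)) - b * Real.cos (k * (ℓ - x))) := by
  rw [derivWithin_congr hf (hf hx)]
  exact (hasDerivAt_cos_sin a b k ℓ x).hasDerivWithinAt.derivWithin (uniqueDiffOn_Icc hℓ x hx)

/-- Eigenfunctions on the star are cosines on each edge. -/
theorem exists_amplitudes {k : ℝ} (hk : 0 < k) {ψ : (starGraph m).Point → ℝ}
    (hψ : (starGraph m).IsEigenfunction (k ^ 2) ψ) :
    ∃ A : (starGraph m).E → ℝ,
      (∀ e s, ψ ((starGraph m).onEdge e s) =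
        A e * Real.cos (k * ((starGraph m).length e - s))) ∧
      (∃ e, A e ≠ 0) ∧
      (∀ e, A e * Real.cos (k * (starGraph m).length e) =
        ψ ((starGraph m).vertex (center m))) ∧
      ∑ e, A e * Real.sin (k * (starGraph m).length e) = 0 := by
  obtain ⟨hne, ⟨⟨hC, -⟩, -, hK⟩, hE⟩ := hψ
  have h1 : ∀ e, ∃ a, EqOn ((starGraph m).restr ψ e)
      (fun x => a * Real.cos (k * ((starGraph m).length e - x)) +
        0 * Real.sin (k * ((starGraph m).length e - x)))
      (Icc 0 ((starGraph m).length e)) := by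
    intro e
    have hℓ := (starGraph m).length_pos e
    obtain ⟨g, h, hg, hh, heq⟩ := hE e
    obtain ⟨a, b, hab⟩ :=
      exists_eqOn_cos_sin_of_hasWeakDeriv hℓ hk (hC.continuous_restr e) hg hh heq
    have hb := hK ((starGraph m).t e)
    rw [normalDeriv_t, derivWithin_of_eqOn_cos_sin hℓ hab (right_mem_Icc.2 hℓ.le)] at hb
    -- At a leaf Kirchhoff's condition is Neumann's, `-k b = 0`, which removes the sine.
    have hb0 : b = 0 := by simpa [hk.ne'] using hb
    subst hb0
    exact ⟨a, hab⟩
  choose A hA using h1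
  have h2 : ∀ e s, ψ ((starGraph m).onEdge e s) =
      A e * Real.cos (k * ((starGraph m).length e - s)) := by
    intro e s
    have := hA e s.2
    rw [restr_of_mem _ _ _ s.2] at this
    simpa using this
  refine ⟨A, h2, ?_, fun e => ?_, ?_⟩
  · by_contra! h0
    refine hne (funext fun x => ?_)
    obtain ⟨e, s, rfl⟩ := exists_eq_onEdge x
    rw [h2, h0, zero_mul]
    rfl
  · rw [← o_eq e, ← onEdge_zero, h2, sub_zero]
  · have h3 := hK (center m)
    rw [normalDeriv_center, neg_eq_zero] at h3
    have h4 : ∀ e, derivWithin ((starGraph m).restr ψ e) (Icc 0 ((starGraph m).length e)) 0 =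
        k * (A e * Real.sin (k * (starGraph m).length e)) := by
      intro e
      have hℓ := (starGraph m).length_pos e
      rw [derivWithin_of_eqOn_cos_sin hℓ (hA e) (left_mem_Icc.2 hℓ.le)]
      simp
    rw [Finset.sum_congr rfl fun e _ => h4 e, ← Finset.mul_sum] at h3
    exact (mul_eq_zero.1 h3).resolve_left hk.ne'

/-- Conversely, suitable cosines on the edges make up an eigenfunction on the star. -/
theorem exists_isEigenfunction {k c : ℝ} {A : (starGraph m).E → ℝ} (hA : ∃ e, A e ≠ 0)
    (hc : ∀ e, A e * Real.cos (k * (starGraph m).length e) = c)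
    (hs : ∑ e, A e * Real.sin (k * (starGraph m).length e) = 0) :
    ∃ ψ, (starGraph m).IsEigenfunction (k ^ 2) ψ ∧ ∀ e s, ψ ((starGraph m).onEdge e s) =
        A e * Real.cos (k * ((starGraph m).length e - s)) := by
  let F : (starGraph m).E → ℝ → ℝ := fun e x => A e * Real.cos (k * ((starGraph m).length e - x))
  -- The star vertex gets the common value `c`, and the leaf of `e` gets `A e = A e * cos 0`.
  let ψ : (starGraph m).Point → ℝ := (starGraph m).glueFun F (fun v => Option.elim v c A)
    (fun e => by simp only [F, sub_zero]; exact hc e) (fun e => by simp [F]; rfl)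
  have hψ : ∀ e s, ψ ((starGraph m).onEdge e s) =
      A e * Real.cos (k * ((starGraph m).length e - s)) := fun e s => rfl
  have hr : ∀ e, EqOn ((starGraph m).restr ψ e) (F e) (Icc 0 ((starGraph m).length e)) :=
    fun e x hx => by rw [restr_of_mem _ _ _ hx, hψ]
  have hr' : ∀ e, EqOn ((starGraph m).restr ψ e)
      (fun x => A e * Real.cos (k * ((starGraph m).length e - x)) +
        0 * Real.sin (k * ((starGraph m).length e - x)))
      (Icc 0 ((starGraph m).length e)) := fun e x hx => by rw [hr e hx]; simp [F]
  have hF : ∀ e, ContDiff ℝ ∞ (F e) := fun e => by fun_prop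
  have hS : ∀ n e, MemSobolev ((starGraph m).length e) n ((starGraph m).restr ψ e) := fun n e =>
    MemSobolev.of_contDiff ((starGraph m).length_pos e) n
      ((hr e).mono Ioo_subset_Icc_self) (hF e)
  refine ⟨ψ, ⟨?_, ⟨⟨fun e => ?_, hS 1⟩, hS 2, fun v => ?_⟩, fun e => ?_⟩, hψ⟩
  · intro h0
    obtain ⟨e, he⟩ := hA
    have := hψ e ⟨(starGraph m).length e, right_mem_Icc.2 ((starGraph m).length_pos e).le⟩
    rw [h0] at this
    simp at this
    exact he this.symm
  · exact (hF e).continuous.continuousOn.congr (hr e)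
  · obtain rfl | ⟨e, rfl⟩ := vertex_cases v
    · rw [normalDeriv_center, neg_eq_zero]
      refine Eq.trans ?_ (mul_eq_zero_of_right k hs)
      rw [Finset.mul_sum]
      refine Finset.sum_congr rfl fun e _ => ?_
      have hℓ := (starGraph m).length_pos e
      rw [derivWithin_of_eqOn_cos_sin hℓ (hr' e) (left_mem_Icc.2 hℓ.le)]
      simp
    · have hℓ := (starGraph m).length_pos e
      rw [normalDeriv_t, derivWithin_of_eqOn_cos_sin hℓ (hr' e) (right_mem_Icc.2 hℓ.le)]
      simp
  · have hℓ := (starGraph m).length_pos e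
    set ℓ := (starGraph m).length e
    have hd1 : ∀ x, HasDerivAt (F e) (k * A e * Real.sin (k * (ℓ - x))) x := fun x => by
      simpa [F, mul_assoc] using hasDerivAt_cos_sin (A e) 0 k ℓ x
    have hd2 : ∀ x, HasDerivAt (fun x => k * A e * Real.sin (k * (ℓ - x)))
        (-(k ^ 2 * F e x)) x := fun x => by
      have := hasDerivAt_cos_sin 0 (k * A e) k ℓ x
      simp only [zero_mul, zero_add] at this
      refine this.congr_deriv ?_
      simp only [F]; ring
    refine ⟨_, _, HasWeakDeriv.of_hasDerivAt hℓ ((hr e).mono Ioo_subset_Icc_self) hd1 (by fun_prop),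
      HasWeakDeriv.of_hasDerivAt hℓ (fun _ _ => rfl) hd2 (by fun_prop), ?_⟩
    filter_upwards [ae_restrict_mem measurableSet_Ioo] with x hx
    rw [hr e (Ioo_subset_Icc_self hx), neg_neg]

/-! ### Secular equation and the first positive eigenvalue -/

/-- The secular equation of the star. -/
theorem secular {k c : ℝ} (hk : 0 < k) (hkπ : k < Real.pi) {A : (starGraph m).E → ℝ}
    (hA : ∀ e, A e * Real.cos (k * (starGraph m).length e) = c) :
    (∀ i, A (short i) = A (long m) * (Real.cos k / Real.cos (k / 2))) ∧
    (∑ e, A e * Real.sin (k * (starGraph m).length e)) * Real.cos (k / 2) =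
      A (long m) * Real.sin (k / 2) * (1 + (m + 1) * Real.cos k) := by
  have hcos : 0 < Real.cos (k / 2) := Real.cos_pos_of_mem_Ioo ⟨by linarith, by linarith⟩
  have h0 := hA (long m)
  rw [length_long, mul_one] at h0
  have h1 : ∀ i, A (short i) = A (long m) * (Real.cos k / Real.cos (k / 2)) := by
    intro i
    have := hA (short i)
    rw [length_short, mul_one_div] at this
    field_simp
    linarith
  refine ⟨h1, ?_⟩
  rw [sum_edges, length_long, mul_one]
  simp only [length_short, h1, mul_one_div, Finset.sum_const, Finset.card_univ, Fintype.card_fin,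
    nsmul_eq_mul]
  have hk2 : k = 2 * (k / 2) := by ring
  have e1 : Real.sin k = 2 * Real.sin (k / 2) * Real.cos (k / 2) := by
    rw [← Real.sin_two_mul, ← hk2]
  have e2 : Real.cos k = 2 * Real.cos (k / 2) ^ 2 - 1 := by
    rw [← Real.cos_two_mul, ← hk2]
  rw [e1]
  field_simp
  rw [e2]
  ring

/-- The square root of the smallest positive eigenvalue of the star. -/
def freq (m : ℕ) : ℝ := Real.arccos (-(1 / (m + 1)))

theorem one_div_le (m : ℕ) : 1 / ((m : ℝ) + 1) ≤ 1 := by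
  rw [div_le_one (by positivity)]
  linarith [Nat.cast_nonneg (α := ℝ) m]

theorem cos_freq (m : ℕ) : Real.cos (freq m) = -(1 / (m + 1)) := by
  have h : (0 : ℝ) < 1 / (m + 1) := by positivity
  exact Real.cos_arccos (by linarith [one_div_le m]) (by linarith)

theorem cos_freq_neg (m : ℕ) : Real.cos (freq m) < 0 := by
  rw [cos_freq, neg_lt_zero]
  positivity

theorem freq_pos (m : ℕ) : 0 < freq m := by
  have h : (0 : ℝ) < 1 / (m + 1) := by positivity
  exact Real.arccos_pos.2 (by linarith)

/-- With at least one short edge `-1/(m+1)` differs from `-1`. Strictness keeps `cos (freq m / 2)`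
positive, so that the short amplitudes are determined by the long one. -/
theorem freq_lt_pi (hm : 1 ≤ m) : freq m < Real.pi := by
  refine (Real.arccos_le_pi _).lt_of_ne fun h => ?_
  have h1 := cos_freq m
  rw [freq, h, Real.cos_pi, neg_inj, eq_div_iff (by positivity)] at h1
  have : (1 : ℝ) ≤ m := by exact_mod_cast hm
  linarith

theorem cos_freq_half_pos (hm : 1 ≤ m) : 0 < Real.cos (freq m / 2) :=
  Real.cos_pos_of_mem_Ioo ⟨by linarith [freq_pos m, Real.pi_pos], by linarith [freq_lt_pi hm]⟩

/-- There is an eigenfunction with any given non-zero amplitude on the long edge. -/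
theorem exists_isEigenfunction_freq (hm : 1 ≤ m) {a : ℝ} (ha : a ≠ 0) :
    ∃ ψ, (starGraph m).IsEigenfunction (freq m ^ 2) ψ ∧
      (∀ s, ψ ((starGraph m).onEdge (long m) s) = a * Real.cos (freq m * (1 - s))) ∧
      ∀ i s, ψ ((starGraph m).onEdge (short i) s) =
        a * (Real.cos (freq m) / Real.cos (freq m / 2)) * Real.cos (freq m * (1 / 2 - s)) := by
  have hcos := cos_freq_half_pos hm
  let A : (starGraph m).E → ℝ := fun e =>
    Option.elim e a fun _ => a * (Real.cos (freq m) / Real.cos (freq m / 2))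
  have hl : A (long m) = a := rfl
  have hsh : ∀ i, A (short i) = a * (Real.cos (freq m) / Real.cos (freq m / 2)) := fun _ => rfl
  have hA : ∀ e, A e * Real.cos (freq m * (starGraph m).length e) = a * Real.cos (freq m) := by
    intro e
    obtain rfl | ⟨i, rfl⟩ := edge_cases e
    · rw [length_long, mul_one, hl]
    · rw [length_short, mul_one_div, hsh]
      field_simp
  have h := (secular (freq_pos m) (freq_lt_pi hm) hA).2
  have hz : 1 + ((m : ℝ) + 1) * Real.cos (freq m) = 0 := by
    rw [cos_freq]
    field_simp
    ring
  rw [hz, mul_zero] at h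
  obtain ⟨ψ, h1, h2⟩ := exists_isEigenfunction ⟨long m, ha⟩ hA
    ((mul_eq_zero.1 h).resolve_right hcos.ne')
  exact ⟨ψ, h1, fun s => h2 _ s, fun i s => h2 _ s⟩

/-- Below `freq m` the cosine exceeds `-1/(m+1)`, so the secular factor is positive; the long
amplitude then vanishes, and all others with it. -/
theorem mu₂_eq (hm : 1 ≤ m) : (starGraph m).mu₂ = freq m ^ 2 := by
  have hmem : freq m ^ 2 ∈ {μ : ℝ | 0 < μ ∧ ∃ ψ, (starGraph m).IsEigenfunction μ ψ} := by
    obtain ⟨ψ, hψ, -⟩ := exists_isEigenfunction_freq hm one_ne_zero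
    exact ⟨pow_pos (freq_pos m) 2, ψ, hψ⟩
  refine le_antisymm (csInf_le ⟨0, fun μ hμ => hμ.1.le⟩ hmem) (le_csInf ⟨_, hmem⟩ ?_)
  rintro μ ⟨hμ, ψ, hψ⟩
  by_contra! hlt
  have hk : 0 < √μ := Real.sqrt_pos.2 hμ
  have hkf : √μ < freq m := (Real.sqrt_lt' (freq_pos m)).2 hlt
  have hkπ : √μ < Real.pi := hkf.trans (freq_lt_pi hm)
  rw [← Real.sq_sqrt hμ.le] at hψ
  obtain ⟨A, -, ⟨e, he⟩, hc, hs⟩ := exists_amplitudes hk hψ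
  obtain ⟨h1, h2⟩ := secular hk hkπ hc
  rw [hs, zero_mul] at h2
  have hcos := Real.cos_lt_cos_of_nonneg_of_le_pi hk.le (freq_lt_pi hm).le hkf
  rw [cos_freq] at hcos
  have h3 : 0 < 1 + ((m : ℝ) + 1) * Real.cos √μ := by
    have hm' : (0 : ℝ) < m + 1 := by positivity
    have := mul_lt_mul_of_pos_left hcos hm'
    field_simp at this
    linarith
  have h4 : 0 < Real.sin (√μ / 2) := Real.sin_pos_of_pos_of_lt_pi (by linarith) (by linarith)
  have h5 : A (long m) = 0 := by simpa [h3.ne', h4.ne'] using h2.symm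
  obtain rfl | ⟨i, rfl⟩ := edge_cases e
  · exact he h5
  · exact he (by rw [h1, h5, zero_mul])

/-- An eigenfunction to the smallest positive eigenvalue has both signs at the leaves. -/
theorem exists_amplitudes_mu₂ (hm : 1 ≤ m) {ψ : (starGraph m).Point → ℝ}
    (hψ : (starGraph m).IsEigenfunction (starGraph m).mu₂ ψ) :
    ∃ A : (starGraph m).E → ℝ,
      (∀ e s, ψ ((starGraph m).onEdge e s) =
        A e * Real.cos (freq m * ((starGraph m).length e - s))) ∧
      (∀ e, A e ≠ 0) ∧ ∃ e, 0 < A e := by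
  rw [mu₂_eq hm] at hψ
  obtain ⟨A, hA, ⟨e, he⟩, hc, -⟩ := exists_amplitudes (freq_pos m) hψ
  have h1 := (secular (freq_pos m) (freq_lt_pi hm) hc).1
  have hd := div_neg_of_neg_of_pos (cos_freq_neg m) (cos_freq_half_pos hm)
  have hl : A (long m) ≠ 0 := by
    intro h0
    obtain rfl | ⟨i, rfl⟩ := edge_cases e
    · exact he h0
    · exact he (by rw [h1, h0, zero_mul])
  refine ⟨A, hA, fun e => ?_, ?_⟩
  · obtain rfl | ⟨i, rfl⟩ := edge_cases e
    · exact hl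
    · rw [h1]
      exact mul_ne_zero hl hd.ne
  · rcases hl.lt_or_gt with h | h
    · refine ⟨short ⟨0, hm⟩, ?_⟩
      rw [h1]
      exact mul_pos_of_neg_of_neg h hd
    · exact ⟨long m, h⟩

/-! ### Hot spots are exactly the leaves -/

/-- The leaves of the star. -/
def leaves (m : ℕ) : Set (starGraph m).Point :=
  range fun e => (starGraph m).vertex ((starGraph m).t e)

theorem encard_leaves : (leaves m).encard = ((m + 1 : ℕ) : ℕ∞) := by
  have hinj : Function.Injective fun e => (starGraph m).vertex ((starGraph m).t e) :=
    (starGraph m).vertex_injective.comp t_injective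
  rw [leaves, ← image_univ, hinj.encard_image, encard_univ, ENat.card_eq_coe_fintype_card,
    card_edges]

/-- Long amplitude `1` serves the long leaf: the short edges carry values `≤ 0`. Long amplitude `-1`
serves all short leaves, which share one value. -/
theorem leaves_subset_M (hm : 1 ≤ m) : leaves m ⊆ (starGraph m).M := by
  rintro _ ⟨e, rfl⟩
  have hf := freq_pos m
  have hfπ := freq_lt_pi hm
  have hneg := cos_freq_neg m
  have hpos := cos_freq_half_pos hm
  have hd := div_neg_of_neg_of_pos hneg hpos
  have hlong : ∀ s ∈ Icc (0 : ℝ) 1, Real.cos (freq m) ≤ Real.cos (freq m * (1 - s)) := by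
    intro s hs
    refine Real.cos_le_cos_of_nonneg_of_le_pi (mul_nonneg hf.le (by linarith [hs.2])) hfπ.le ?_
    nlinarith [hs.1]
  have hshort : ∀ s ∈ Icc (0 : ℝ) (1 / 2), 0 ≤ Real.cos (freq m * (1 / 2 - s)) := by
    intro s hs
    refine Real.cos_nonneg_of_mem_Icc ⟨?_, ?_⟩
    · nlinarith [hs.2, Real.pi_pos]
    · nlinarith [hs.1]
  simp only [← onEdge_length]
  obtain rfl | ⟨i, rfl⟩ := edge_cases e
  · obtain ⟨ψ, hψ, hl, hs⟩ := exists_isEigenfunction_freq hm one_ne_zero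
    refine ⟨ψ, by rwa [mu₂_eq hm], fun y => ?_⟩
    obtain ⟨e', s, rfl⟩ := exists_eq_onEdge y
    rw [hl]
    obtain rfl | ⟨j, rfl⟩ := edge_cases e'
    · rw [hl]
      simp [length_long, Real.cos_le_one]
    · rw [hs, one_mul]
      simp only [length_long, sub_self, mul_zero, Real.cos_zero, one_mul]
      exact (mul_nonpos_of_nonpos_of_nonneg hd.le (hshort s s.2)).trans zero_le_one
  · obtain ⟨ψ, hψ, hl, hs⟩ := exists_isEigenfunction_freq hm (neg_ne_zero.2 one_ne_zero)
    refine ⟨ψ, by rwa [mu₂_eq hm], fun y => ?_⟩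
    obtain ⟨e', s, rfl⟩ := exists_eq_onEdge y
    rw [hs]
    simp only [length_short, sub_self, mul_zero, Real.cos_zero, mul_one]
    obtain rfl | ⟨j, rfl⟩ := edge_cases e'
    · rw [hl]
      have h1 := hlong s s.2
      -- Dividing a negative number by a number in `(0, 1]` does not increase it. Hence the value at
      -- the short leaves is at least `-cos (freq m)`, the bound on the long edge.
      have h2 : Real.cos (freq m) / Real.cos (freq m / 2) ≤ Real.cos (freq m) := by
        rw [div_le_iff₀ hpos]
        nlinarith [Real.cos_le_one (freq m / 2)]
      linarith
    · rw [hs]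
      nlinarith [Real.cos_le_one (freq m * (1 / 2 - s))]

/-- A global maximum is at least the value at a leaf of positive amplitude, hence non-zero. -/
theorem M_subset_MLoc (hm : 1 ≤ m) : (starGraph m).M ⊆ (starGraph m).MLoc := by
  rintro x ⟨ψ, hψ, hmax⟩
  obtain ⟨A, hA, -, e, he⟩ := exists_amplitudes_mu₂ hm hψ
  have h := hmax ((starGraph m).onEdge e
    ⟨(starGraph m).length e, right_mem_Icc.2 ((starGraph m).length_pos e).le⟩)
  rw [hA, sub_self, mul_zero, Real.cos_zero, mul_one] at h
  exact ⟨ψ, hψ, (he.trans_le h).ne', 1, one_pos, fun y _ => hmax y⟩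

theorem MLoc_subset_leaves (hm : 1 ≤ m) : (starGraph m).MLoc ⊆ leaves m := by
  rintro x ⟨ψ, hψ, -, ε, hε, hmax⟩
  obtain ⟨A, hA, hA0, e', he'⟩ := exists_amplitudes_mu₂ hm hψ
  have hf := freq_pos m
  have hle : ∀ e, freq m * (starGraph m).length e ≤ Real.pi := fun e =>
    (mul_le_of_le_one_right hf.le (length_le_one e)).trans (freq_lt_pi hm).le
  have hend : ∀ e s, x = (starGraph m).onEdge e s → 0 < A e → (s : ℝ) = (starGraph m).length e := by
    rintro e s rfl he
    by_contra hs
    obtain ⟨y, hy, hlt⟩ := exists_lt_of_pos_mul_cos _ he hf (hle e) (hA e)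
      (lt_of_le_of_ne s.2.2 hs) hε
    exact (hmax y hy).not_gt hlt
  obtain ⟨e, s, hx⟩ := exists_eq_onEdge x
  rcases (hA0 e).lt_or_gt with he | he
  · exfalso
    have hs : (s : ℝ) = 0 := by
      by_contra hs
      subst hx
      obtain ⟨y, hy, hlt⟩ := exists_lt_of_neg_mul_cos _ he hf (hle e) (hA e)
        (lt_of_le_of_ne s.2.1 (Ne.symm hs)) hε
      exact (hmax y hy).not_gt hlt
    have h0 : s = ⟨0, left_mem_Icc.2 ((starGraph m).length_pos e).le⟩ := Subtype.ext hs
    -- The remaining candidate is the star vertex; seen as the initial point of the positive edge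
    -- `e'`, it would have to be the terminal point of `e'`.
    rw [h0, onEdge_zero, o_eq, ← o_eq e', ← onEdge_zero] at hx
    exact ((starGraph m).length_pos e').ne (hend e' _ hx he')
  · have h1 : s = ⟨(starGraph m).length e, right_mem_Icc.2 ((starGraph m).length_pos e).le⟩ :=
      Subtype.ext (hend e s hx he)
    rw [hx, h1, onEdge_length]
    exact ⟨e, rfl⟩

end starGraph

end MetricGraph

end

theorem proposition4p4 (n : ℕ) (hn : 2 ≤ n) :
    ∃ Γ : MetricGraph,
      (∃ ε : ℝ, 0 < ε ∧ ε < 1 ∧ Γ.IsStarWith n 1 ε) ∧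
      Γ.M.encard = (n : ℕ∞) ∧ Γ.MLoc.encard = (n : ℕ∞) := by
  obtain ⟨m, rfl⟩ : ∃ m, n = m + 1 := ⟨n - 1, by omega⟩
  have hm : 1 ≤ m := by omega
  have h1 := MetricGraph.starGraph.leaves_subset_M hm
  have h2 := MetricGraph.starGraph.M_subset_MLoc hm
  have h3 := MetricGraph.starGraph.MLoc_subset_leaves hm
  refine ⟨MetricGraph.starGraph m,
    ⟨1 / 2, by norm_num, by norm_num, MetricGraph.starGraph.isStarWith m⟩, ?_, ?_⟩
  · rw [(h2.trans h3).antisymm h1, MetricGraph.starGraph.encard_leaves]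
  · rw [h3.antisymm (h1.trans h2), MetricGraph.starGraph.encard_leaves]
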